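/- **Theorem 1.** Let $G$ be a finite group and let $A$ and $B$ be subgroups of $G$ such that $G=AB$ is the mutually permutable product of $A$ and $B$, that is, $G=AB$, $UB=BU$ for every subgroup $U\le A$, and $AV=VA$ for every subgroup $V\le B$. Suppose that $A$ and $B$ are supersoluble (a group $H$ is supersoluble if it has a finite series $1=H_0\le H_1\le\dots\le H_n=H$ of normal subgroups of $H$ with all factors $H_{i+1}/H_i$ cyclic). Then $$G^{\mathfrak U}=(G')^{\mathfrak N}=[A,B]^{\mathfrak N}.$$ Here $G'$ is the derived subgroup of $G$ and $[A,B]=\langle [a,b] \mid a\in A,\ b\in B\rangle$; for a finite group $K$, $K^{\mathfrak U}$ denotes the supersoluble residual of $K$, i.e. the smallest normal subgroup of $K$ with supersoluble quotient, and $K^{\mathfrak N}$ denotes the nilpotent residual of $K$, i.e. the smallest normal subgroup of $K$ with nilpotent quotient. -/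

import Mathlib

open scoped Pointwise

universe u

/-- A group is supersoluble if it has a finite series
`1 = H 0 ≤ H 1 ≤ ⋯ ≤ H n = G` of subgroups that are all normal in `G`, with every factor
`H (i + 1) / H i` cyclic. -/
def IsSupersoluble (G : Type u) [Group G] : Prop :=
  ∃ (n : ℕ) (H : ℕ → Subgroup G) (_ : ∀ i, (H i).Normal),
    H 0 = ⊥ ∧ H n = ⊤ ∧
      ∀ i < n, H i ≤ H (i + 1) ∧ IsCyclic (H (i + 1) ⧸ (H i).subgroupOf (H (i + 1)))

/-- `G` is the mutually permutable product of its subgroups `A` and `B`: `G = AB`, every subgroup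
of `A` permutes with `B`, and every subgroup of `B` permutes with `A`. -/
structure IsMutuallyPermutableProduct {G : Type u} [Group G] (A B : Subgroup G) : Prop where
  mul_eq : (A : Set G) * (B : Set G) = Set.univ
  left_permutes : ∀ U : Subgroup G, U ≤ A → (U : Set G) * (B : Set G) = (B : Set G) * (U : Set G)
  right_permutes : ∀ V : Subgroup G, V ≤ B → (A : Set G) * (V : Set G) = (V : Set G) * (A : Set G)

/-- The set of normal subgroups `N` of `G` such that `G / N` belongs to the class `F`. -/
def normalWithQuotientIn (F : ∀ (H : Type u) [Group H], Prop) (G : Type u) [Group G] :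
    Set (Subgroup G) :=
  {N | ∃ _ : N.Normal, F (G ⧸ N)}

/-- The `F`-residual of `G`: the intersection of all normal subgroups of `G` with quotient in `F`.
For a finite group and for the classes of nilpotent and of supersoluble groups it is the smallest
such subgroup, as shown below. -/
def classResidual (F : ∀ (H : Type u) [Group H], Prop) (G : Type u) [Group G] : Subgroup G :=
  sInf (normalWithQuotientIn F G)

/-- The supersoluble residual of `G`. -/
def supersolubleResidual (G : Type u) [Group G] : Subgroup G :=
  classResidual (fun H [Group H] => IsSupersoluble H) G

/-- The nilpotent residual of a subgroup `K` of `G`, as a subgroup of `G`. -/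
def nilpotentResidual {G : Type u} [Group G] (K : Subgroup G) : Subgroup G :=
  (classResidual (fun H [Group H] => Group.IsNilpotent H) K).map K.subtype

theorem classResidual_isLeast (F : ∀ (H : Type u) [Group H], Prop)
    (hone : ∀ (H : Type u) [Group H], Subsingleton H → F H)
    (hinj : ∀ (H K : Type u) [Group H] [Group K] (f : H →* K), Function.Injective f → F K → F H)
    (hprod : ∀ (H K : Type u) [Group H] [Group K], F H → F K → F (H × K))
    (G : Type u) [Group G] [Finite G] :
    IsLeast (normalWithQuotientIn F G) (classResidual F G) := by
  refine ⟨?_, fun N hN => sInf_le hN⟩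
  have key : ∀ s : Set (Subgroup G), s.Finite → s ⊆ normalWithQuotientIn F G →
      sInf s ∈ normalWithQuotientIn F G := by
    intro s hs
    induction s, hs using Set.Finite.induction_on with
    | empty =>
      intro _
      rw [sInf_empty]
      exact ⟨inferInstance, hone _ (QuotientGroup.subsingleton_quotient_top)⟩
    | @insert N s _ _ ih =>
      intro h
      obtain ⟨hN, hFN⟩ := h (Set.mem_insert _ _)
      obtain ⟨hM, hFM⟩ := ih fun x hx => h (Set.mem_insert_of_mem _ hx)
      rw [sInf_insert]
      refine ⟨inferInstance, hinj _ _ (QuotientGroup.lift (N ⊓ sInf s)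
        ((QuotientGroup.mk' N).prod (QuotientGroup.mk' (sInf s))) ?_) ?_ (hprod _ _ hFN hFM)⟩
      · rintro x ⟨hx, hx'⟩
        ext
        · exact (QuotientGroup.eq_one_iff x).2 hx
        · exact (QuotientGroup.eq_one_iff x).2 hx'
      · rw [injective_iff_map_eq_one]
        intro x
        induction x using QuotientGroup.induction_on with
        | H x =>
          intro hx
          have h1 : (x : G ⧸ N) = 1 := congrArg Prod.fst hx
          have h2 : (x : G ⧸ sInf s) = 1 := congrArg Prod.snd hx
          exact (QuotientGroup.eq_one_iff x).2
            ⟨(QuotientGroup.eq_one_iff x).1 h1, (QuotientGroup.eq_one_iff x).1 h2⟩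
  exact key _ (Set.toFinite _) subset_rfl

theorem isCyclic_factor_of_hom {G K : Type u} [Group G] [Group K] (f : G →* K)
    (N M : Subgroup G) (N' M' : Subgroup K) [N.Normal] [N'.Normal]
    (hM : M ≤ M'.comap f) (hN : N ≤ N'.comap f) (h : M ⊓ N'.comap f ≤ N)
    (hc : IsCyclic (M' ⧸ N'.subgroupOf M')) : IsCyclic (M ⧸ N.subgroupOf M) := by
  let g : M →* M' := (f.comp M.subtype).codRestrict M' fun x => hM x.2
  refine isCyclic_of_injective (QuotientGroup.map (N.subgroupOf M) (N'.subgroupOf M') g ?_) ?_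
  · intro x hx
    exact Subgroup.mem_subgroupOf.2 (hN (Subgroup.mem_subgroupOf.1 hx))
  · rw [injective_iff_map_eq_one]
    intro x
    induction x using QuotientGroup.induction_on with
    | H x =>
      intro hx
      have hx' : g x ∈ N'.subgroupOf M' := (QuotientGroup.eq_one_iff (g x)).1 hx
      exact (QuotientGroup.eq_one_iff x).2
        (Subgroup.mem_subgroupOf.2 (h ⟨x.2, Subgroup.mem_subgroupOf.1 hx'⟩))

theorem IsSupersoluble.of_subsingleton (G : Type u) [Group G] (h : Subsingleton G) :
    IsSupersoluble G :=
  ⟨0, fun _ => ⊥, fun _ => inferInstance, rfl, Subsingleton.elim _ _, fun i hi => by omega⟩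

theorem IsSupersoluble.of_injective (G K : Type u) [Group G] [Group K] (f : G →* K)
    (hf : Function.Injective f) (hK : IsSupersoluble K) : IsSupersoluble G := by
  obtain ⟨n, H, hH, h0, hn, hs⟩ := hK
  refine ⟨n, fun i => (H i).comap f, fun i => inferInstance, ?_, ?_, fun i hi => ⟨?_, ?_⟩⟩
  · simp only [h0]
    exact (MonoidHom.ker_eq_bot_iff f).2 hf
  · simp only [hn, Subgroup.comap_top]
  · exact Subgroup.comap_mono (hs i hi).1
  · exact isCyclic_factor_of_hom f _ _ (H i) (H (i + 1)) le_rfl le_rfl inf_le_right (hs i hi).2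

theorem IsSupersoluble.prod (G K : Type u) [Group G] [Group K]
    (hG : IsSupersoluble G) (hK : IsSupersoluble K) : IsSupersoluble (G × K) := by
  obtain ⟨n, H, hH, h0, hn, hs⟩ := hG
  obtain ⟨m, L, hL, l0, lm, ls⟩ := hK
  let S : ℕ → Subgroup (G × K) := fun i =>
    if i ≤ n then (H i).prod ⊥ else (⊤ : Subgroup G).prod (L (i - n))
  have hlow : ∀ i, i ≤ n → S i = (H i).prod ⊥ := fun i hi => if_pos hi
  have hhigh : ∀ j, S (n + j) = (⊤ : Subgroup G).prod (L j) := by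
    intro j
    rcases Nat.eq_zero_or_pos j with rfl | hj
    · rw [Nat.add_zero, hlow n le_rfl, hn, l0]
    · simp only [S]
      rw [if_neg (by omega), Nat.add_sub_cancel_left]
  have hS : ∀ i, (S i).Normal := by
    intro i
    simp only [S]
    split_ifs <;> infer_instance
  refine ⟨n + m, S, hS, ?_, ?_, fun i hi => ?_⟩
  · rw [hlow 0 (Nat.zero_le _), h0, Subgroup.bot_prod_bot]
  · rw [hhigh, lm, Subgroup.top_prod_top]
  · rcases lt_or_ge i n with hin | hin
    · have e1 := hlow i hin.le
      have e2 := hlow (i + 1) hin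
      refine ⟨?_, isCyclic_factor_of_hom (MonoidHom.fst G K) _ _ (H i) (H (i + 1))
        ?_ ?_ ?_ (hs i hin).2⟩
      · rw [e1, e2]
        exact Subgroup.prod_mono (hs i hin).1 le_rfl
      · rw [e2]
        exact fun x hx => hx.1
      · rw [e1]
        exact fun x hx => hx.1
      · rw [e1, e2]
        exact fun x hx => ⟨hx.2, hx.1.2⟩
    · obtain ⟨j, rfl⟩ := Nat.exists_eq_add_of_le hin
      have hj : j < m := by omega
      have e1 := hhigh j
      have e2 : S (n + j + 1) = _ := hhigh (j + 1)
      refine ⟨?_, isCyclic_factor_of_hom (MonoidHom.snd G K) _ _ (L j) (L (j + 1))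
        ?_ ?_ ?_ (ls j hj).2⟩
      · rw [e1, e2]
        exact Subgroup.prod_mono le_rfl (ls j hj).1
      · rw [e2]
        exact fun x hx => hx.2
      · rw [e1]
        exact fun x hx => hx.2
      · rw [e1, e2]
        exact fun x hx => ⟨hx.1.1, hx.2⟩

/-- The supersoluble residual of a finite group is its smallest normal subgroup with supersoluble
quotient. -/
theorem supersolubleResidual_isLeast (G : Type u) [Group G] [Finite G] :
    IsLeast (normalWithQuotientIn (fun H [Group H] => IsSupersoluble H) G) (supersolubleResidual G) :=
  classResidual_isLeast _ (fun H _ => IsSupersoluble.of_subsingleton H)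
    (fun H K _ _ f => IsSupersoluble.of_injective H K f)
    (fun H K _ _ => IsSupersoluble.prod H K) G

/-- The nilpotent residual of a finite group is its smallest normal subgroup with nilpotent
quotient. -/
theorem nilpotentResidual_isLeast (G : Type u) [Group G] [Finite G] :
    IsLeast (normalWithQuotientIn (fun H [Group H] => Group.IsNilpotent H) G)
      (classResidual (fun H [Group H] => Group.IsNilpotent H) G) :=
  classResidual_isLeast (fun H [Group H] => Group.IsNilpotent H)
    (fun _ [Group _] _ => inferInstance)
    (fun _ _ _ _ f hf hK => by
      have := hK
      exact Subgroup.isNilpotent_of_ker_le_center f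
        (((MonoidHom.ker_eq_bot_iff f).2 hf).le.trans bot_le))
    (fun _ _ _ _ h1 h2 => by
      have := h1
      have := h2
      infer_instance) G

/-!
The three residuals are compared in a cycle `G^𝔘 ≤ [A, B]^𝔑 ≤ (G')^𝔑 ≤ G^𝔘`. The second inequality
is monotonicity of the nilpotent residual, and the third holds because the derived subgroup of a
supersoluble group is nilpotent (`IsSupersoluble.isNilpotent_commutator`). As mutually permutable
products pass to quotients, the first inequality amounts to
`IsMutuallyPermutableProduct.isSupersoluble`: if `A` and `B` are supersoluble and `[A, B]` is
nilpotent, then `G` is supersoluble.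

By induction on the order of `G` it is enough to find a nontrivial normal cyclic subgroup. If
`[A, B] = 1`, a normal cyclic subgroup of one of the factors will do. Otherwise let `N` be a minimal
normal subgroup of `G` inside the centre of `[A, B]`. Each factor, say `A`, normalizes some
nontrivial cyclic subgroup `⟨x⟩` of `N`:
* if `N ∩ A ≠ 1`, because `A` is supersoluble;
* if `N ∩ A = 1`, because there is a cyclic `U ≤ B ∩ NA` such that `U ∩ A` has prime index `q` in
  `U`; since `UA` is a subgroup, `N ∩ UA` has order `q` and is normalized by `A`
  (`exists_zpowers_normalized_of_inf_eq_bot`).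

As `[A, B]` centralizes `N`, the actions of `A` and `B` on `N` commute, so that the "eigenspace" of
`A` in `N` containing `x` is normal in `G` and therefore equal to `N`
(`IsMutuallyPermutableProduct.conj_mem_zpowers`). Thus `A` acts on `N` by power maps, and so does `B`,
whence every cyclic subgroup of `N` is normal in `G`.
-/

open scoped commutatorElement

/-! ### Supersoluble groups -/

/-- A nontrivial normal subgroup of a supersoluble group contains a nontrivial normal cyclic
subgroup of the whole group: its first nontrivial intersection with the given normal series. -/
theorem IsSupersoluble.exists_zpowers_normal {G : Type u} [Group G] (hG : IsSupersoluble G)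
    (K : Subgroup G) [hK : K.Normal] (hK' : K ≠ ⊥) :
    ∃ x ∈ K, x ≠ 1 ∧ ∀ g : G, g * x * g⁻¹ ∈ Subgroup.zpowers x := by
  classical
  obtain ⟨n, H, hH, h0, hn, hs⟩ := hG
  have hex : ∃ i, H i ⊓ K ≠ ⊥ := ⟨n, by rwa [hn, top_inf_eq]⟩
  obtain ⟨j, hj⟩ : ∃ j, Nat.find hex = j + 1 := by
    refine Nat.exists_eq_succ_of_ne_zero fun h => Nat.find_spec hex ?_
    rw [h, h0, bot_inf_eq]
  have hjn : j < n := by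
    have : Nat.find hex ≤ n := Nat.find_min' hex (by rwa [hn, top_inf_eq])
    omega
  have hbot : H j ⊓ K = ⊥ := by
    by_contra h
    have := Nat.find_min' hex h
    omega
  have hne : H (j + 1) ⊓ K ≠ ⊥ := hj ▸ Nat.find_spec hex
  obtain ⟨-, hcyc⟩ := hs j hjn
  let f : ↥(H (j + 1) ⊓ K) →* H (j + 1) ⧸ (H j).subgroupOf (H (j + 1)) :=
    (QuotientGroup.mk' _).comp (Subgroup.inclusion inf_le_left)
  have hf : Function.Injective f := by
    rw [injective_iff_map_eq_one]
    intro x hx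
    have hx' := Subgroup.mem_subgroupOf.1 ((QuotientGroup.eq_one_iff _).1 hx)
    have : (x : G) ∈ H j ⊓ K := ⟨hx', x.2.2⟩
    rw [hbot, Subgroup.mem_bot] at this
    exact Subtype.ext this
  have : IsCyclic ↥(H (j + 1) ⊓ K) := isCyclic_of_injective f hf
  obtain ⟨x, hx⟩ := (Subgroup.isCyclic_iff_exists_zpowers_eq_top (H (j + 1) ⊓ K)).1 this
  have hxm : x ∈ H (j + 1) ⊓ K := hx ▸ Subgroup.mem_zpowers x
  refine ⟨x, hxm.2, ?_, fun g => ?_⟩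
  · rintro rfl
    exact hne (by rw [← hx, Subgroup.zpowers_one_eq_bot])
  · have := hH (j + 1)
    rw [hx]
    exact (inferInstance : (H (j + 1) ⊓ K).Normal).conj_mem x hxm g

theorem IsSupersoluble.of_surjective {G K : Type u} [Group G] [Group K] (f : G →* K)
    (hf : Function.Surjective f) (hG : IsSupersoluble G) : IsSupersoluble K := by
  obtain ⟨n, H, hH, h0, hn, hs⟩ := hG
  refine ⟨n, fun i => (H i).map f, fun i => (hH i).map f hf, ?_, ?_, fun i hi => ⟨?_, ?_⟩⟩
  · simp only [h0, Subgroup.map_bot]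
  · simp only [hn, Subgroup.map_top_of_surjective f hf]
  · exact Subgroup.map_mono (hs i hi).1
  · have hc := (hs i hi).2
    have := (hH i).map f hf
    refine isCyclic_of_surjective (QuotientGroup.map ((H i).subgroupOf (H (i + 1)))
      (((H i).map f).subgroupOf ((H (i + 1)).map f)) (f.subgroupMap (H (i + 1))) ?_) ?_
    · intro x hx
      have hx' : f x ∈ (H i).map f := Subgroup.mem_map_of_mem f (Subgroup.mem_subgroupOf.1 hx)
      rwa [Subgroup.mem_comap, Subgroup.mem_subgroupOf]
    · intro y
      induction y using QuotientGroup.induction_on with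
      | H y =>
        obtain ⟨x, rfl⟩ := f.subgroupMap_surjective _ y
        exact ⟨QuotientGroup.mk x, rfl⟩

/-- An extension of a normal cyclic subgroup by a supersoluble group is supersoluble. -/
theorem IsSupersoluble.of_isCyclic_of_quotient {G : Type u} [Group G] (C : Subgroup G) [C.Normal]
    (hC : IsCyclic C) (hQ : IsSupersoluble (G ⧸ C)) : IsSupersoluble G := by
  obtain ⟨n, H, hH, h0, hn, hs⟩ := hQ
  let π := QuotientGroup.mk' C
  obtain ⟨S, hS0, hS⟩ : ∃ S : ℕ → Subgroup G, S 0 = ⊥ ∧ ∀ j, S (j + 1) = (H j).comap π :=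
    ⟨fun i => Nat.rec ⊥ (fun j _ => (H j).comap π) i, rfl, fun _ => rfl⟩
  have hS1 : S 1 = C := by rw [hS, h0, MonoidHom.comap_bot, QuotientGroup.ker_mk']
  have hSn : ∀ i, (S i).Normal := by
    rintro (_ | j)
    · rw [hS0]
      infer_instance
    · rw [hS]
      exact (hH j).comap _
  refine ⟨n + 1, S, hSn, hS0, ?_, ?_⟩
  · rw [hS, hn, Subgroup.comap_top]
  · rintro (_ | j) hi
    · refine ⟨hS0 ▸ bot_le, ?_⟩
      have : IsCyclic (S 1) := hS1 ▸ hC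
      have := hSn 0
      exact isCyclic_of_surjective (G := ↥(S 1) ⧸ (S 0).subgroupOf (S 1))
        (QuotientGroup.mk' ((S 0).subgroupOf (S 1))) (QuotientGroup.mk'_surjective _)
    · obtain ⟨hle, hc⟩ := hs j (by omega)
      have e1 := hS j
      have e2 := hS (j + 1)
      exact ⟨by rw [e1, e2]; exact Subgroup.comap_mono hle, isCyclic_factor_of_hom π _ _
        (H j) (H (j + 1)) e2.le e1.le (inf_le_right.trans e1.ge) hc⟩

/-- The derived subgroup centralizes every cyclic normal subgroup, because the automorphism group
of a cyclic group is abelian. -/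
theorem commute_of_mem_commutator_of_isCyclic {G : Type u} [Group G] (C : Subgroup G) [C.Normal]
    [IsCyclic C] {x g : G} (hx : x ∈ C) (hg : g ∈ commutator G) : g * x = x * g := by
  obtain ⟨c, hc⟩ := IsCyclic.exists_generator (α := C)
  have hcomm : ∀ φ ψ : MulAut C, φ * ψ = ψ * φ := by
    intro φ ψ
    have key : ∀ θ : MulAut C, ∃ k : ℤ, ∀ y, θ y = y ^ k := by
      intro θ
      obtain ⟨k, hk⟩ := Subgroup.mem_zpowers_iff.1 (hc (θ c))
      refine ⟨k, fun y => ?_⟩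
      obtain ⟨m, rfl⟩ := Subgroup.mem_zpowers_iff.1 (hc y)
      rw [map_zpow, ← hk, ← zpow_mul, ← zpow_mul, mul_comm]
    obtain ⟨k, hk⟩ := key φ
    obtain ⟨l, hl⟩ := key ψ
    ext1 y
    rw [MulAut.mul_apply, MulAut.mul_apply, hl, hk, hk, hl, ← zpow_mul, ← zpow_mul, mul_comm]
  have hle : commutator G ≤ (MulAut.conjNormal (H := C)).ker := by
    rw [commutator_def, Subgroup.commutator_le]
    intro a _ b _
    rw [MonoidHom.mem_ker, map_commutatorElement, commutatorElement_eq_one_iff_mul_comm]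
    exact hcomm _ _
  have h1 : MulAut.conjNormal g = (1 : MulAut C) := hle hg
  have h2 : ((MulAut.conjNormal g) (⟨x, hx⟩ : C) : G) = x := by rw [h1]; rfl
  rw [MulAut.conjNormal_apply] at h2
  exact mul_inv_eq_iff_eq_mul.1 h2

/-- The intersections of the derived subgroup with a normal series with cyclic factors form a
central series. -/
theorem IsSupersoluble.isNilpotent_commutator {G : Type u} [Group G] (hG : IsSupersoluble G) :
    Group.IsNilpotent (commutator G) := by
  obtain ⟨n, H, hH, h0, hn, hs⟩ := hG
  rw [Subgroup.nilpotent_iff_finite_ascending_central_series]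
  -- The series is made constant from `n` on, since nothing is known about `H i` for `n < i`.
  refine ⟨n, fun i => (H (min i n)).subgroupOf (commutator G), ⟨?_, ?_⟩, ?_⟩
  · simp [h0]
  · intro x i hx g
    change x ∈ (H (min (i + 1) n)).subgroupOf (commutator G) at hx
    change ⁅x, g⁆ ∈ (H (min i n)).subgroupOf (commutator G)
    rcases lt_or_ge i n with hi | hi
    · rw [min_eq_left (Nat.succ_le_of_lt hi)] at hx
      rw [min_eq_left hi.le]
      have hc := (hs i hi).2
      let q := QuotientGroup.mk' (H i)
      have := (hH (i + 1)).map q (QuotientGroup.mk'_surjective _)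
      have : IsCyclic ((H (i + 1)).map q) := by
        refine isCyclic_of_surjective (QuotientGroup.lift ((H i).subgroupOf (H (i + 1)))
          (q.subgroupMap (H (i + 1))) ?_) ?_
        · intro y hy
          exact Subtype.ext ((QuotientGroup.eq_one_iff _).2 (Subgroup.mem_subgroupOf.1 hy))
        · intro y
          obtain ⟨z, rfl⟩ := q.subgroupMap_surjective _ y
          exact ⟨QuotientGroup.mk z, rfl⟩
      have hqg : q g ∈ commutator (G ⧸ H i) := by
        have hle : (commutator G).map q ≤ commutator (G ⧸ H i) := by
          rw [commutator_def, commutator_def, Subgroup.map_commutator]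
          exact Subgroup.commutator_mono le_top le_top
        exact hle (Subgroup.mem_map_of_mem q g.2)
      have hqx : q x ∈ (H (i + 1)).map q := Subgroup.mem_map_of_mem q (Subgroup.mem_subgroupOf.1 hx)
      have h := commute_of_mem_commutator_of_isCyclic _ hqx hqg
      rw [Subgroup.mem_subgroupOf]
      refine (QuotientGroup.eq_one_iff _).1 ?_
      change q (⁅x, g⁆ : commutator G) = 1
      simp only [commutatorElement_def, Subgroup.coe_mul, Subgroup.coe_inv, map_mul, map_inv]
      rw [← h]
      group
    · rw [min_eq_right hi, hn]
      exact Subgroup.mem_subgroupOf.2 (Subgroup.mem_top _)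
  · simp [hn]

/-! ### Permuting subgroups -/

theorem Subgroup.coe_sup_of_mul_comm {G : Type u} [Group G] {H K : Subgroup G}
    (h : (H : Set G) * (K : Set G) = (K : Set G) * (H : Set G)) :
    ((H ⊔ K : Subgroup G) : Set G) = (H : Set G) * (K : Set G) := by
  let S : Subgroup G :=
    { carrier := (H : Set G) * (K : Set G)
      one_mem' := ⟨1, H.one_mem, 1, K.one_mem, one_mul 1⟩
      mul_mem' := by
        intro x y hx hy
        have : x * y ∈ ((H : Set G) * (K : Set G)) * ((H : Set G) * (K : Set G)) :=
          Set.mul_mem_mul hx hy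
        rwa [mul_assoc, ← mul_assoc (K : Set G), ← h, mul_assoc, coe_mul_coe, ← mul_assoc,
          coe_mul_coe] at this
      inv_mem' := by
        rintro _ ⟨x, hx, y, hy, rfl⟩
        change (x * y)⁻¹ ∈ (H : Set G) * (K : Set G)
        rw [h, mul_inv_rev]
        exact Set.mul_mem_mul (K.inv_mem hy) (H.inv_mem hx) }
  refine Set.Subset.antisymm ?_ ?_
  · have : H ⊔ K ≤ S := sup_le (fun x hx => ⟨x, hx, 1, K.one_mem, mul_one x⟩)
      (fun x hx => ⟨1, H.one_mem, x, hx, one_mul x⟩)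
    exact this
  · rintro _ ⟨x, hx, y, hy, rfl⟩
    exact mul_mem_sup hx hy

theorem Subgroup.eq_map_inf_comap {G K : Type*} [Group G] [Group K] (f : G →* K) {A : Subgroup G}
    {U : Subgroup K} (hU : U ≤ A.map f) : U = (A ⊓ U.comap f).map f := by
  refine SetLike.coe_injective ?_
  rw [coe_map, coe_inf, coe_comap, Set.image_inter_preimage, ← coe_map]
  exact (Set.inter_eq_right.2 hU).symm

/-- If `q` is the least positive exponent with `a ^ q ∈ B` and `N` meets `B` trivially, where `⟨a⟩`
permutes with `B` and `a ∈ NB`, then `N ∩ ⟨a⟩B` has `q` elements: it represents the cosets of `B`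
in `⟨a⟩B`, as do the powers `a ^ i` with `i < q`. -/
theorem card_inf_zpowers_sup {G : Type u} [Group G] {B N : Subgroup G} [N.Normal]
    (hNB : N ⊓ B = ⊥) {a : G} {q : ℕ} (hq : 0 < q)
    (hperm : (Subgroup.zpowers a : Set G) * (B : Set G) = (B : Set G) * (Subgroup.zpowers a : Set G))
    (haN : a ∈ N ⊔ B) (haq : a ^ q ∈ B) (hmin : ∀ d, 0 < d → d < q → a ^ d ∉ B) :
    Nat.card ↥(N ⊓ (Subgroup.zpowers a ⊔ B)) = q := by
  let f : ↥(N ⊓ (Subgroup.zpowers a ⊔ B)) → G ⧸ B := fun m => QuotientGroup.mk (m : G)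
  let g : Fin q → G ⧸ B := fun i => QuotientGroup.mk (a ^ (i : ℕ))
  have hf : Function.Injective f := by
    intro m m' h
    have h1 : (m : G)⁻¹ * m' ∈ N ⊓ B :=
      ⟨N.mul_mem (N.inv_mem m.2.1) m'.2.1, QuotientGroup.eq.1 h⟩
    rw [hNB, Subgroup.mem_bot, inv_mul_eq_one] at h1
    exact Subtype.ext h1
  have hg : Function.Injective g := by
    have key : ∀ i j : Fin q, i < j → g i ≠ g j := by
      intro i j hij h
      have hij' : (i : ℕ) < j := hij
      have hj := j.2
      refine hmin ((j : ℕ) - i) (by omega) (by omega) ?_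
      have h1 := QuotientGroup.eq.1 h
      rwa [← zpow_natCast, ← zpow_natCast, ← zpow_neg, ← zpow_add, neg_add_eq_sub,
        ← Nat.cast_sub hij'.le, zpow_natCast] at h1
    intro i j h
    rcases lt_trichotomy i j with hij | hij | hij
    · exact absurd h (key i j hij)
    · exact hij
    · exact absurd h.symm (key j i hij)
  have hrange : Set.range f = Set.range g := by
    refine Set.Subset.antisymm ?_ ?_
    · rintro _ ⟨⟨m, hm, hm'⟩, rfl⟩
      obtain ⟨_, ⟨z, rfl⟩, b, hb, rfl⟩ : m ∈ (Subgroup.zpowers a : Set G) * (B : Set G) :=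
        Subgroup.coe_sup_of_mul_comm hperm ▸ hm'
      have hq' : (0 : ℤ) < q := by exact_mod_cast hq
      have h0 := Int.emod_nonneg z hq'.ne'
      have h1 := Int.emod_lt_of_pos z hq'
      refine ⟨⟨(z % q).toNat, by omega⟩, ?_⟩
      refine QuotientGroup.eq.2 ?_
      have h2 : (a ^ (z % q).toNat)⁻¹ * (a ^ z * b) = (a ^ q) ^ (z / q) * b := by
        rw [← zpow_natCast a (z % q).toNat, Int.toNat_of_nonneg h0, ← mul_assoc, ← zpow_neg,
          ← zpow_add, ← zpow_natCast a q, ← zpow_mul]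
        congr 2
        have := Int.emod_add_mul_ediv z q
        linarith
      change (a ^ (z % q).toNat)⁻¹ * (a ^ z * b) ∈ B
      rw [h2]
      exact B.mul_mem (B.zpow_mem haq _) hb
    · rintro _ ⟨i, rfl⟩
      have hi : a ^ (i : ℕ) ∈ N ⊔ B := Subgroup.pow_mem _ haN _
      rw [← SetLike.mem_coe, Subgroup.normal_mul] at hi
      obtain ⟨m, hm, b, hb, hmb⟩ := hi
      have hmb' : m * b = a ^ (i : ℕ) := hmb
      have hm' : m ∈ Subgroup.zpowers a ⊔ B := by
        rw [eq_mul_inv_of_mul_eq hmb']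
        exact Subgroup.mul_mem_sup (Subgroup.npow_mem_zpowers a _) (B.inv_mem hb)
      have hmB : m⁻¹ * a ^ (i : ℕ) ∈ B := by
        rw [← hmb', inv_mul_cancel_left]
        exact hb
      exact ⟨⟨m, hm, hm'⟩, QuotientGroup.eq.2 hmB⟩
  rw [← Nat.card_range_of_injective hf, hrange, Nat.card_range_of_injective hg, Nat.card_fin]

/-- If `G = AB`, every subgroup of `A` permutes with `B` and the nontrivial normal subgroup `N`
meets `B` trivially, then `B` normalizes a nontrivial cyclic subgroup of `N`. It has the form
`N ∩ UB`, for a cyclic `U ≤ A ∩ NB` whose intersection with `B` has prime index in `U`. -/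
theorem exists_zpowers_normalized_of_inf_eq_bot {G : Type u} [Group G] [Finite G]
    {A B N : Subgroup G} [N.Normal] (hmul : (A : Set G) * (B : Set G) = Set.univ)
    (hperm : ∀ U : Subgroup G, U ≤ A → (U : Set G) * (B : Set G) = (B : Set G) * (U : Set G))
    (hNB : N ⊓ B = ⊥) (hN : N ≠ ⊥) :
    ∃ x ∈ N, x ≠ 1 ∧ ∀ b ∈ B, b * x * b⁻¹ ∈ Subgroup.zpowers x := by
  classical
  obtain ⟨n, hn, hn1⟩ := (Subgroup.bot_or_exists_ne_one N).resolve_left hN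
  obtain ⟨a, ha, b, hb, hab⟩ : n ∈ (A : Set G) * (B : Set G) := hmul ▸ Set.mem_univ _
  have hab' : a * b = n := hab
  have haB : a ∉ B := by
    intro h
    have : n ∈ N ⊓ B := ⟨hn, hab' ▸ B.mul_mem h hb⟩
    rw [hNB] at this
    exact hn1 this
  have haN : a ∈ N ⊔ B := by
    rw [eq_mul_inv_of_mul_eq hab']
    exact Subgroup.mul_mem_sup hn (B.inv_mem hb)
  have hex : ∃ r, 0 < r ∧ a ^ r ∈ B :=
    ⟨orderOf a, orderOf_pos a, by rw [pow_orderOf_eq_one]; exact B.one_mem⟩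
  -- `r` is the order of `a` modulo `B`; passing to a power of `a` makes it a prime `q`.
  set r := Nat.find hex
  obtain ⟨hr0, hrB⟩ : 0 < r ∧ a ^ r ∈ B := Nat.find_spec hex
  have hmin : ∀ d, 0 < d → d < r → a ^ d ∉ B := fun d hd hdr h => Nat.find_min hex hdr ⟨hd, h⟩
  have hr1 : r ≠ 1 := fun h => haB (by rwa [h, pow_one] at hrB)
  obtain ⟨q, hq, k, hk⟩ := Nat.exists_prime_and_dvd hr1
  have hk0 : 0 < k := Nat.pos_of_ne_zero fun h => by simp [h] at hk; omega
  have hU : Subgroup.zpowers (a ^ k) ≤ A := by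
    rw [Subgroup.zpowers_le]
    exact A.pow_mem ha k
  have hcard := card_inf_zpowers_sup hNB hq.pos (hperm _ hU) (Subgroup.pow_mem _ haN k)
    (by rwa [← pow_mul, mul_comm, ← hk]) (fun d hd hdq h => by
      rw [← pow_mul] at h
      refine hmin (k * d) (Nat.mul_pos hk0 hd) ?_ h
      rw [hk, mul_comm]
      exact Nat.mul_lt_mul_of_pos_right hdq hk0)
  set M := N ⊓ (Subgroup.zpowers (a ^ k) ⊔ B)
  have : Fact q.Prime := ⟨hq⟩
  have : Nontrivial M := Finite.one_lt_card_iff_nontrivial.1 (hcard ▸ hq.one_lt)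
  obtain ⟨x, hx⟩ := exists_ne (1 : M)
  refine ⟨x, x.2.1, fun h => hx (Subtype.ext h), fun b hb => ?_⟩
  have hbM : b * x * b⁻¹ ∈ M := by
    have hb' : b ∈ Subgroup.zpowers (a ^ k) ⊔ B := le_sup_right (a := Subgroup.zpowers (a ^ k)) hb
    exact ⟨Subgroup.Normal.conj_mem inferInstance _ x.2.1 b,
      Subgroup.mul_mem _ (Subgroup.mul_mem _ hb' x.2.2) (Subgroup.inv_mem _ hb')⟩
  obtain ⟨z, hz⟩ := Subgroup.mem_zpowers_iff.1
    (mem_zpowers_of_prime_card hcard hx : (⟨_, hbM⟩ : M) ∈ Subgroup.zpowers x)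
  exact Subgroup.mem_zpowers_iff.2 ⟨z, by simpa using congrArg Subtype.val hz⟩

/-! ### Mutually permutable products -/

namespace IsMutuallyPermutableProduct

theorem symm {G : Type u} [Group G] {A B : Subgroup G} (h : IsMutuallyPermutableProduct A B) :
    IsMutuallyPermutableProduct B A where
  mul_eq := by rw [← h.left_permutes A le_rfl, h.mul_eq]
  left_permutes V hV := (h.right_permutes V hV).symm
  right_permutes U hU := (h.left_permutes U hU).symm

theorem map {G K : Type u} [Group G] [Group K] {A B : Subgroup G}
    (h : IsMutuallyPermutableProduct A B) (f : G →* K) (hf : Function.Surjective f) :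
    IsMutuallyPermutableProduct (A.map f) (B.map f) where
  mul_eq := by
    rw [Subgroup.coe_map, Subgroup.coe_map, ← Set.image_mul, h.mul_eq, Set.image_univ, hf.range_eq]
  left_permutes U hU := by
    have hU' : U = (A ⊓ U.comap f).map f := Subgroup.eq_map_inf_comap f hU
    rw [hU', Subgroup.coe_map, Subgroup.coe_map, ← Set.image_mul, ← Set.image_mul,
      h.left_permutes _ inf_le_left]
  right_permutes V hV := by
    have hV' : V = (B ⊓ V.comap f).map f := Subgroup.eq_map_inf_comap f hV
    rw [hV', Subgroup.coe_map, Subgroup.coe_map, ← Set.image_mul, ← Set.image_mul,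
      h.right_permutes _ inf_le_left]

theorem sup_eq_top {G : Type u} [Group G] {A B : Subgroup G}
    (h : IsMutuallyPermutableProduct A B) : A ⊔ B = ⊤ := by
  rw [eq_top_iff]
  intro g _
  obtain ⟨a, ha, b, hb, rfl⟩ : g ∈ (A : Set G) * (B : Set G) := h.mul_eq ▸ Set.mem_univ g
  exact Subgroup.mul_mem_sup ha hb

theorem normal_of_forall_conj_mem {G : Type u} [Group G] {A B : Subgroup G}
    (h : IsMutuallyPermutableProduct A B) {K : Subgroup G}
    (hA : ∀ a ∈ A, ∀ x ∈ K, a * x * a⁻¹ ∈ K) (hB : ∀ b ∈ B, ∀ x ∈ K, b * x * b⁻¹ ∈ K) :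
    K.Normal := by
  refine ⟨fun x hx g => ?_⟩
  obtain ⟨a, ha, b, hb, rfl⟩ : g ∈ (A : Set G) * (B : Set G) := h.mul_eq ▸ Set.mem_univ g
  have := hA a ha _ (hB b hb x hx)
  simpa only [mul_inv_rev, mul_assoc] using this

theorem normal_commutator {G : Type u} [Group G] {A B : Subgroup G}
    (h : IsMutuallyPermutableProduct A B) : ⁅A, B⁆.Normal := by
  rw [← Subgroup.normalizer_eq_top_iff, eq_top_iff, ← h.sup_eq_top]
  exact sup_le (Subgroup.normalizer_commutator_ge_left A B)
    (Subgroup.normalizer_commutator_ge_right A B)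

/-- A supersoluble `A` normalizes a nontrivial cyclic subgroup of every nontrivial normal subgroup
`N`: if `N ∩ A = 1` this comes from the permutability of the subgroups of `B` with `A`, and
otherwise from the supersolubility of `A`. -/
theorem exists_zpowers_normalized {G : Type u} [Group G] [Finite G] {A B : Subgroup G}
    (h : IsMutuallyPermutableProduct A B) (hA : IsSupersoluble A) {N : Subgroup G} [N.Normal]
    (hN : N ≠ ⊥) : ∃ x ∈ N, x ≠ 1 ∧ ∀ a ∈ A, a * x * a⁻¹ ∈ Subgroup.zpowers x := by
  by_cases hNA : N ⊓ A = ⊥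
  · exact exists_zpowers_normalized_of_inf_eq_bot h.symm.mul_eq h.symm.left_permutes hNA hN
  · obtain ⟨x, hx, hx1, hxA⟩ := hA.exists_zpowers_normal (N.subgroupOf A)
      (fun h' => hNA (by rwa [Subgroup.subgroupOf_eq_bot, disjoint_iff] at h'))
    refine ⟨x, Subgroup.mem_subgroupOf.1 hx, fun h' => hx1 (Subtype.ext h'), fun a ha => ?_⟩
    obtain ⟨z, hz⟩ := Subgroup.mem_zpowers_iff.1 (hxA ⟨a, ha⟩)
    exact Subgroup.mem_zpowers_iff.2 ⟨z, by simpa using congrArg Subtype.val hz⟩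

/-- Let `N` be an abelian minimal normal subgroup of `G` that is centralized by `[A, B]`. Then a
supersoluble `A` normalizes every cyclic subgroup of `N`: for a nontrivial `x ∈ N` such that `A`
normalizes `⟨x⟩`, the elements of `N` on which each `a ∈ A` acts as the same power map as on `x`
form a normal subgroup of `G`, because the actions of `A` and `B` on `N` commute. -/
theorem conj_mem_zpowers {G : Type u} [Group G] [Finite G] {A B : Subgroup G}
    (h : IsMutuallyPermutableProduct A B) (hA : IsSupersoluble A) {N : Subgroup G} [N.Normal]
    (hN : N ≠ ⊥) (hmin : ∀ L : Subgroup G, L.Normal → L ≠ ⊥ → L ≤ N → N ≤ L)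
    (habel : ∀ x ∈ N, ∀ y ∈ N, x * y = y * x) (hcent : ∀ c ∈ ⁅A, B⁆, ∀ x ∈ N, c * x = x * c)
    {a y : G} (ha : a ∈ A) (hy : y ∈ N) : a * y * a⁻¹ ∈ Subgroup.zpowers y := by
  obtain ⟨x, hx, hx1, hxA⟩ := h.exists_zpowers_normalized hA hN
  let E : Subgroup G :=
    { carrier := {y | y ∈ N ∧ ∀ a ∈ A, ∀ k : ℤ, a * x * a⁻¹ = x ^ k → a * y * a⁻¹ = y ^ k}
      one_mem' := ⟨N.one_mem, fun a _ k _ => by simp⟩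
      mul_mem' := by
        rintro y z ⟨hy, hy'⟩ ⟨hz, hz'⟩
        refine ⟨N.mul_mem hy hz, fun a ha k hk => ?_⟩
        rw [Commute.mul_zpow (habel y hy z hz), ← hy' a ha k hk, ← hz' a ha k hk]
        group
      inv_mem' := by
        rintro y ⟨hy, hy'⟩
        refine ⟨N.inv_mem hy, fun a ha k hk => ?_⟩
        rw [inv_zpow, ← hy' a ha k hk]
        group }
  have hE : E.Normal := by
    refine h.normal_of_forall_conj_mem ?_ ?_
    · rintro a ha y ⟨hy, hy'⟩
      obtain ⟨k, hk⟩ := Subgroup.mem_zpowers_iff.1 (hxA a ha)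
      rw [hy' a ha k hk.symm]
      exact E.zpow_mem ⟨hy, hy'⟩ k
    · rintro b hb y ⟨hy, hy'⟩
      have hby : b * y * b⁻¹ ∈ N := Subgroup.Normal.conj_mem inferInstance y hy b
      refine ⟨hby, fun a ha k hk => ?_⟩
      have haby : b * (a * y * a⁻¹) * b⁻¹ ∈ N := Subgroup.Normal.conj_mem inferInstance _
        (Subgroup.Normal.conj_mem inferInstance y hy a) b
      have hc := hcent ⁅a, b⁆ (Subgroup.commutator_mem_commutator ha hb) _ haby
      calc a * (b * y * b⁻¹) * a⁻¹
          = ⁅a, b⁆ * (b * (a * y * a⁻¹) * b⁻¹) * ⁅a, b⁆⁻¹ := by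
            rw [commutatorElement_def]; group
        _ = b * (a * y * a⁻¹) * b⁻¹ := by rw [hc, mul_inv_cancel_right]
        _ = (b * y * b⁻¹) ^ k := by rw [hy' a ha k hk, conj_zpow]
  have hxE : x ∈ E := ⟨hx, fun _ _ _ hk => hk⟩
  have hyE := hmin E hE (fun h' => hx1 (by rwa [h', Subgroup.mem_bot] at hxE)) (fun _ h => h.1) hy
  obtain ⟨k, hk⟩ := Subgroup.mem_zpowers_iff.1 (hxA a ha)
  exact Subgroup.mem_zpowers_iff.2 ⟨k, (hyE.2 a ha k hk.symm).symm⟩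

/-- If `[A, B] = 1` and `A` is nontrivial, then a normal cyclic subgroup of `A` is normal in `G`,
since `B` centralizes it. -/
theorem exists_zpowers_normal_of_commutator_eq_bot {G : Type u} [Group G] {A B : Subgroup G}
    (h : IsMutuallyPermutableProduct A B) (hA : IsSupersoluble A) (hA' : A ≠ ⊥)
    (hAB : ⁅A, B⁆ = ⊥) : ∃ x : G, x ≠ 1 ∧ ∀ g : G, g * x * g⁻¹ ∈ Subgroup.zpowers x := by
  have : Nontrivial A := (Subgroup.nontrivial_iff_ne_bot A).2 hA'
  obtain ⟨x, -, hx1, hx⟩ := hA.exists_zpowers_normal ⊤ top_ne_bot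
  refine ⟨x, fun h' => hx1 (Subtype.ext h'), fun g => ?_⟩
  obtain ⟨a, ha, b, hb, rfl⟩ : g ∈ (A : Set G) * (B : Set G) := h.mul_eq ▸ Set.mem_univ g
  have hbx : b * x * b⁻¹ = x := by
    have hc : ⁅(x : G), b⁆ = 1 := by
      rw [← Subgroup.mem_bot, ← hAB]
      exact Subgroup.commutator_mem_commutator x.2 hb
    rw [commutatorElement_eq_one_iff_mul_comm] at hc
    rw [← hc, mul_inv_cancel_right]
  obtain ⟨z, hz⟩ := Subgroup.mem_zpowers_iff.1 (hx ⟨a, ha⟩)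
  refine Subgroup.mem_zpowers_iff.2 ⟨z, ?_⟩
  have hz' : (x : G) ^ z = a * x * a⁻¹ := by simpa using congrArg Subtype.val hz
  rw [hz']
  change a * x * a⁻¹ = a * b * x * (a * b)⁻¹
  rw [mul_inv_rev]
  nth_rewrite 1 [← hbx]
  group

/-- If `[A, B]` is nilpotent and nontrivial, a minimal normal subgroup of `G` inside the centre
of `[A, B]` is normalized, along with all its cyclic subgroups, by `A` and by `B`. -/
theorem exists_zpowers_normal {G : Type u} [Group G] [Finite G] [Nontrivial G] {A B : Subgroup G}
    (h : IsMutuallyPermutableProduct A B) (hA : IsSupersoluble A) (hB : IsSupersoluble B)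
    (hnil : Group.IsNilpotent ↥⁅A, B⁆) :
    ∃ x : G, x ≠ 1 ∧ ∀ g : G, g * x * g⁻¹ ∈ Subgroup.zpowers x := by
  by_cases hAB : ⁅A, B⁆ = ⊥
  · by_cases hA' : A = ⊥
    · have hB' : B ≠ ⊥ := by
        rintro rfl
        have := h.sup_eq_top
        rw [hA', bot_sup_eq] at this
        exact bot_ne_top this
      exact h.symm.exists_zpowers_normal_of_commutator_eq_bot hB hB'
        (by rwa [Subgroup.commutator_comm])
    · exact h.exists_zpowers_normal_of_commutator_eq_bot hA hA' hAB
  have hnorm := h.normal_commutator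
  have : Nontrivial ↥⁅A, B⁆ := (Subgroup.nontrivial_iff_ne_bot _).2 hAB
  let Z : Subgroup G := (Subgroup.center ↥⁅A, B⁆).map ⁅A, B⁆.subtype
  have hZ : Z.Normal := inferInstance
  have hZ' : Z ≠ ⊥ := by
    rw [Ne, Subgroup.map_eq_bot_iff_of_injective _ (Subgroup.subtype_injective _)]
    exact Group.IsNilpotent.center_ne_bot _
  have hZc : ∀ c ∈ ⁅A, B⁆, ∀ x ∈ Z, c * x = x * c := by
    rintro c hc _ ⟨x, hx, rfl⟩
    exact congrArg Subtype.val (Subgroup.mem_center_iff.1 hx ⟨c, hc⟩)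
  obtain ⟨N, hNZ, hNmin⟩ := exists_minimal_le_of_wellFoundedLT
    (fun L : Subgroup G => L.Normal ∧ L ≠ ⊥) Z ⟨hZ, hZ'⟩
  obtain ⟨hN, hN'⟩ := hNmin.prop
  have hmin : ∀ L : Subgroup G, L.Normal → L ≠ ⊥ → L ≤ N → N ≤ L :=
    fun L hL hL' hLN => hNmin.le_of_le ⟨hL, hL'⟩ hLN
  have hcent : ∀ c ∈ ⁅A, B⁆, ∀ x ∈ N, c * x = x * c := fun c hc x hx => hZc c hc x (hNZ hx)
  have habel : ∀ x ∈ N, ∀ y ∈ N, x * y = y * x :=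
    fun x hx y hy => hcent x (Subgroup.map_subtype_le _ (hNZ hx)) y hy
  have hAN : ∀ a ∈ A, ∀ y ∈ N, a * y * a⁻¹ ∈ Subgroup.zpowers y := fun a ha y hy =>
    h.conj_mem_zpowers hA hN' hmin habel hcent ha hy
  have hBN : ∀ b ∈ B, ∀ y ∈ N, b * y * b⁻¹ ∈ Subgroup.zpowers y := fun b hb y hy =>
    h.symm.conj_mem_zpowers hB hN' hmin habel (by rwa [Subgroup.commutator_comm]) hb hy
  obtain ⟨⟨x, hx⟩, hx1⟩ := Subgroup.ne_bot_iff_exists_ne_one.1 hN'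
  refine ⟨x, fun h' => hx1 (Subtype.ext h'), fun g => ?_⟩
  obtain ⟨a, ha, b, hb, rfl⟩ : g ∈ (A : Set G) * (B : Set G) := h.mul_eq ▸ Set.mem_univ g
  have hbx := hBN b hb x hx
  have := hAN a ha _ (hN.conj_mem x hx b)
  have := Subgroup.zpowers_le.2 hbx this
  simpa only [mul_inv_rev, mul_assoc] using this

/-- A mutually permutable product of two supersoluble subgroups `A` and `B` is supersoluble as
soon as `[A, B]` is nilpotent. -/
theorem isSupersoluble {G : Type u} [Group G] [Finite G] {A B : Subgroup G}
    (h : IsMutuallyPermutableProduct A B) (hA : IsSupersoluble A) (hB : IsSupersoluble B)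
    (hnil : Group.IsNilpotent ↥⁅A, B⁆) : IsSupersoluble G := by
  induction hn : Nat.card G using Nat.strong_induction_on generalizing G with
  | _ n ih =>
    subst hn
    rcases subsingleton_or_nontrivial G with hG | hG
    · exact IsSupersoluble.of_subsingleton G hG
    obtain ⟨x, hx1, hx⟩ := h.exists_zpowers_normal hA hB hnil
    let C := Subgroup.zpowers x
    have hC : C.Normal := by
      refine ⟨fun y hy g => ?_⟩
      obtain ⟨k, rfl⟩ := Subgroup.mem_zpowers_iff.1 hy
      rw [← conj_zpow]
      exact C.zpow_mem (hx g) k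
    have hC' : C ≠ ⊥ := by rwa [Ne, Subgroup.zpowers_eq_bot]
    have hlt : Nat.card (G ⧸ C) < Nat.card G := by
      rw [Subgroup.card_eq_card_quotient_mul_card_subgroup C]
      exact lt_mul_of_one_lt_right Nat.card_pos ((Subgroup.one_lt_card_iff_ne_bot C).2 hC')
    let q := QuotientGroup.mk' C
    have hq : Function.Surjective q := QuotientGroup.mk'_surjective C
    refine IsSupersoluble.of_isCyclic_of_quotient C inferInstance
      (ih _ hlt (h.map q hq) (hA.of_surjective _ (q.subgroupMap_surjective A))
        (hB.of_surjective _ (q.subgroupMap_surjective B)) ?_ rfl)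
    rw [← Subgroup.map_commutator]
    exact Group.nilpotent_of_surjective _ (q.subgroupMap_surjective ⁅A, B⁆)

end IsMutuallyPermutableProduct

/-! ### Residuals -/

theorem Group.IsNilpotent.of_injective {G K : Type*} [Group G] [Group K] (f : G →* K)
    (hf : Function.Injective f) (hK : Group.IsNilpotent K) : Group.IsNilpotent G :=
  Subgroup.isNilpotent_of_ker_le_center f (((MonoidHom.ker_eq_bot_iff f).2 hf).le.trans bot_le)

/-- If the image of `f : G → K` in `K / N` is nilpotent, then `f` maps the nilpotent residual
of `G` into `N`. -/
theorem classResidual_isNilpotent_le_comap {G K : Type u} [Group G] [Group K] (f : G →* K)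
    (N : Subgroup K) [N.Normal] (h : Group.IsNilpotent ((QuotientGroup.mk' N).comp f).range) :
    classResidual (fun H [Group H] => Group.IsNilpotent H) G ≤ N.comap f := by
  have hker : ((QuotientGroup.mk' N).comp f).ker = N.comap f := by
    rw [← MonoidHom.comap_ker, QuotientGroup.ker_mk']
  rw [← hker]
  exact sInf_le ⟨inferInstance, Group.IsNilpotent.of_injective
    (QuotientGroup.quotientKerEquivRange _).toMonoidHom (MulEquiv.injective _) h⟩

instance classResidual_isNilpotent_characteristic (G : Type u) [Group G] [Finite G] :
    (classResidual (fun H [Group H] => Group.IsNilpotent H) G).Characteristic := by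
  rw [Subgroup.characteristic_iff_le_comap]
  intro φ
  obtain ⟨_, h⟩ := (nilpotentResidual_isLeast G).1
  exact classResidual_isNilpotent_le_comap φ.toMonoidHom _ inferInstance

instance nilpotentResidual_normal {G : Type u} [Group G] [Finite G] (K : Subgroup G) [K.Normal] :
    (nilpotentResidual K).Normal :=
  ConjAct.normal_of_characteristic_of_normal

theorem isNilpotent_map_mk_nilpotentResidual {G : Type u} [Group G] [Finite G] (K : Subgroup G)
    [K.Normal] : Group.IsNilpotent (K.map (QuotientGroup.mk' (nilpotentResidual K))) := by
  obtain ⟨_, h⟩ := (nilpotentResidual_isLeast K).1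
  let R := classResidual (fun H [Group H] => Group.IsNilpotent H) K
  let q := QuotientGroup.mk' (nilpotentResidual K)
  refine Group.nilpotent_of_surjective (G := K ⧸ R)
    (QuotientGroup.lift R (q.subgroupMap K) ?_) ?_
  · intro x hx
    exact Subtype.ext ((QuotientGroup.eq_one_iff _).2 (Subgroup.mem_map_of_mem K.subtype hx))
  · intro y
    obtain ⟨x, rfl⟩ := q.subgroupMap_surjective K y
    exact ⟨QuotientGroup.mk x, rfl⟩

theorem nilpotentResidual_le {G : Type u} [Group G] {K N : Subgroup G} [N.Normal]
    (h : Group.IsNilpotent (K.map (QuotientGroup.mk' N))) : nilpotentResidual K ≤ N := by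
  rw [nilpotentResidual, Subgroup.map_le_iff_le_comap]
  refine classResidual_isNilpotent_le_comap K.subtype N ?_
  rwa [MonoidHom.range_comp, Subgroup.range_subtype]

theorem nilpotentResidual_mono {G : Type u} [Group G] [Finite G] {K L : Subgroup G} [L.Normal]
    (h : K ≤ L) : nilpotentResidual K ≤ nilpotentResidual L :=
  nilpotentResidual_le <| (isNilpotent_map_mk_nilpotentResidual L).of_injective
    (Subgroup.inclusion (Subgroup.map_mono h)) (Subgroup.inclusion_injective _)

theorem nilpotentResidual_commutator_le_supersolubleResidual (G : Type u) [Group G] [Finite G] :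
    nilpotentResidual (commutator G) ≤ supersolubleResidual G := by
  obtain ⟨_, h⟩ := (supersolubleResidual_isLeast G).1
  refine nilpotentResidual_le ?_
  rw [commutator_def, Subgroup.map_commutator,
    Subgroup.map_top_of_surjective _ (QuotientGroup.mk'_surjective _)]
  exact h.isNilpotent_commutator

theorem theorem1 {G : Type u} [Group G] [Finite G] (A B : Subgroup G)
    (hAB : IsMutuallyPermutableProduct A B) (hA : IsSupersoluble A) (hB : IsSupersoluble B) :
    supersolubleResidual G = nilpotentResidual (commutator G) ∧
      nilpotentResidual (commutator G) = nilpotentResidual ⁅A, B⁆ := by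
  have := hAB.normal_commutator
  have h1 : supersolubleResidual G ≤ nilpotentResidual ⁅A, B⁆ := by
    let q := QuotientGroup.mk' (nilpotentResidual ⁅A, B⁆)
    have hq : Function.Surjective q := QuotientGroup.mk'_surjective _
    refine sInf_le (α := Subgroup G) ⟨inferInstance, (hAB.map q hq).isSupersoluble
      (hA.of_surjective _ (q.subgroupMap_surjective A))
      (hB.of_surjective _ (q.subgroupMap_surjective B)) ?_⟩
    rw [← Subgroup.map_commutator]
    exact isNilpotent_map_mk_nilpotentResidual ⁅A, B⁆
  have h2 : nilpotentResidual ⁅A, B⁆ ≤ nilpotentResidual (commutator G) :=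
    nilpotentResidual_mono (Subgroup.commutator_mono le_top le_top)
  have h3 := nilpotentResidual_commutator_le_supersolubleResidual G
  exact ⟨le_antisymm (h1.trans h2) h3, le_antisymm (h3.trans h1) h2⟩
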